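/- Let $G$ be a locally compact group acting continuously (i.e. with open vertex stabilizers) and without inversion on a tree $\mathcal T$, such that every vertex stabilizer has Kazhdan's Property (T). Let $M$ be a unitary $G$-module, i.e. a complex Hilbert space with a strongly continuous unitary representation of $G$. Let $X=G\backslash\mathcal T$ be the quotient graph, with vertex set $V$ and set of oriented edges $E$; write $e_-$ and $e_+$ for the initial and terminal vertex of an oriented edge $e$, and let $A\subset E$ be an orientation, containing exactly one edge of each pair of opposite edges. Choose a lift $\tilde v$ in $\mathcal T$ of each $v\in V$, a lift $\tilde e$ in $\mathcal T$ of each $e\in A$, and elements $t_e\in G$ ($e\in A$), such that the terminal vertex of $\tilde e$ is $\widetilde{e_+}$ and the initial vertex of $\tilde e$ is $t_e^{-1}\,\widetilde{e_-}$. Let $G_v$ and $G_e$ be the stabilizers of $\tilde v$ and $\tilde e$, write $M^H$ for the subspace of $H$-fixed vectors of $M$, and define $$\iota:\prod_{v\in V}M^{G_v}\to\prod_{e\in A}M^{G_e},\qquad (\iota f)_e=f_{e_+}-t_e^{-1}f_{e_-}.$$ Let $Z^1(G,M)$ be the space of continuous maps $b:G\to M$ with $b(gh)=b(g)+g\,b(h)$,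 with the topology of uniform convergence on compact subsets, let $B^1(G,M)$ be the subspace of the maps $g\mapsto gm-m$ ($m\in M$), and put $H^1(G,M)=Z^1(G,M)/B^1(G,M)$ and $\overline H^1(G,M)=Z^1(G,M)/\overline{B^1(G,M)}$. Then, for all such choices: (i) $H^1(G,M)=0$ if and only if $\iota$ is onto; (ii) $\overline H^1(G,M)=0$ if and only if $\iota$ has dense image, where $\prod_{e\in A}M^{G_e}$ carries the product topology. -/

import Mathlib

universe u v w

/-! ### Unitary modules, first cohomology, Property (T) -/

/-- A unitary `G`-module: a strongly continuous homomorphism from `G` to the group of unitary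
operators of the complex Hilbert space `M`. -/
structure UnitaryRep (G : Type u) [Group G] [TopologicalSpace G]
    (M : Type w) [NormedAddCommGroup M] [InnerProductSpace ℂ M] where
  /-- the action by unitary operators -/
  toHom : G →* (M ≃ₗᵢ[ℂ] M)
  /-- strong continuity -/
  strongly_continuous : ∀ m : M, Continuous fun g : G => toHom g m

namespace UnitaryRep

variable {G : Type u} [Group G] [TopologicalSpace G]
  {M : Type w} [NormedAddCommGroup M] [InnerProductSpace ℂ M]

/-- The subspace `M^H` of vectors fixed by a subgroup `H` of `G`. -/
def fixed (π : UnitaryRep G M) (H : Subgroup G) : Submodule ℂ M where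
  carrier := {m | ∀ h ∈ H, π.toHom h m = m}
  zero_mem' := fun h _ => map_zero (π.toHom h)
  add_mem' := fun {a b} ha hb h hh => by rw [map_add, ha h hh, hb h hh]
  smul_mem' := fun c a ha h hh => by rw [map_smul, ha h hh]

/-- The space `Z¹(G, M)` of continuous 1-cocycles. As a subspace of `C(G, M)` it carries the
compact-open topology, that is, the topology of uniform convergence on compact subsets. -/
def Z1 (π : UnitaryRep G M) : Submodule ℂ C(G, M) where
  carrier := {b | ∀ g h : G, b (g * h) = b g + π.toHom g (b h)}
  zero_mem' := fun g h => by simp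
  add_mem' := fun {a b} ha hb g h => by
    simp only [ContinuousMap.add_apply, map_add, ha g h, hb g h]
    abel
  smul_mem' := fun c a ha g h => by
    simp only [ContinuousMap.smul_apply, map_smul, ha g h, smul_add]

/-- The coboundary `g ↦ g m - m` of a vector `m`. -/
def coboundary (π : UnitaryRep G M) : M →ₗ[ℂ] π.Z1 where
  toFun m := ⟨⟨fun g => π.toHom g m - m, (π.strongly_continuous m).sub continuous_const⟩,
    fun g h => by
      simp only [ContinuousMap.coe_mk, map_mul, map_sub, LinearIsometryEquiv.coe_mul,
        Function.comp_apply]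
      abel⟩
  map_add' m n := by
    ext g
    simp only [ContinuousMap.coe_mk, Submodule.coe_add, ContinuousMap.add_apply, map_add]
    abel
  map_smul' c m := by
    ext g
    simp only [ContinuousMap.coe_mk, Submodule.coe_smul, ContinuousMap.smul_apply, map_smul,
      RingHom.id_apply, smul_sub]

/-- The space `B¹(G, M)` of coboundaries, as a subspace of `Z¹(G, M)`. -/
def B1 (π : UnitaryRep G M) : Submodule ℂ π.Z1 := LinearMap.range π.coboundary

/-- The first cohomology `H¹(G, M)`. -/
abbrev H1 (π : UnitaryRep G M) : Type _ := π.Z1 ⧸ π.B1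

/-- The first reduced cohomology: cocycles modulo the closure of the coboundaries for uniform
convergence on compact subsets. -/
abbrev ReducedH1 (π : UnitaryRep G M) : Type _ := π.Z1 ⧸ π.B1.topologicalClosure

end UnitaryRep

/-- Kazhdan's Property (T): there are a compact subset `Q` and `ε > 0` such that every unitary
representation with a `(Q, ε)`-invariant vector has a nonzero invariant vector. The Hilbert spaces
range over the universe `w`. Property (T) for Hilbert spaces of all universes implies this one, and
is equivalent to it as soon as `w` is at least the universe of `G`. -/
def HasPropertyT (G : Type u) [Group G] [TopologicalSpace G] : Prop :=
  ∃ Q : Set G, IsCompact Q ∧ ∃ ε : ℝ, 0 < ε ∧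
    ∀ (H : Type w) [NormedAddCommGroup H] [InnerProductSpace ℂ H] [CompleteSpace H]
      (π : UnitaryRep G H),
      (∃ ξ : H, ξ ≠ 0 ∧ ∀ g ∈ Q, ‖π.toHom g ξ - ξ‖ < ε * ‖ξ‖) →
        ∃ η : H, η ≠ 0 ∧ ∀ g : G, π.toHom g η = η

/-! ### Group actions on trees

A tree is a `SimpleGraph` with `SimpleGraph.IsTree`; its oriented edges are the darts `d`, with
initial vertex `d.fst`, terminal vertex `d.snd` and opposite edge `d.symm`. -/

/-- The action of `G` on the vertices of `T` is by graph automorphisms. -/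
class ActsOnGraph (G : Type u) [Group G] {V : Type v} [MulAction G V] (T : SimpleGraph V) :
    Prop where
  smul_adj : ∀ (g : G) {x y : V}, T.Adj x y → T.Adj (g • x) (g • y)

section Action

variable (G : Type u) [Group G] {V : Type v} [MulAction G V] (T : SimpleGraph V)
  [ActsOnGraph G T]

/-- The induced action on oriented edges. -/
instance dartAction : MulAction G T.Dart where
  smul g d := ⟨(g • d.fst, g • d.snd), ActsOnGraph.smul_adj g d.adj⟩
  one_smul d := SimpleGraph.Dart.ext _ _ (Prod.ext (one_smul G d.fst) (one_smul G d.snd))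
  mul_smul g h d :=
    SimpleGraph.Dart.ext _ _ (Prod.ext (mul_smul g h d.fst) (mul_smul g h d.snd))

/-- No element of `G` maps an oriented edge to its opposite. -/
def WithoutInversion : Prop := ∀ (g : G) (d : T.Dart), g • d ≠ d.symm

variable (V) in
/-- The vertices of the quotient graph `X = G \ T`. -/
abbrev QuotVertex : Type v := MulAction.orbitRel.Quotient G V

/-- The oriented edges of the quotient graph `X = G \ T`. -/
abbrev QuotEdge : Type v := MulAction.orbitRel.Quotient G T.Dart

variable {G T}

/-- The opposite edge in the quotient graph. -/
def QuotEdge.opp : QuotEdge G T → QuotEdge G T :=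
  Quotient.map' (fun d => d.symm) (by
    rintro _ d ⟨g, rfl⟩
    exact ⟨g, rfl⟩)

/-- The initial vertex `e₋` in the quotient graph. -/
def QuotEdge.init : QuotEdge G T → QuotVertex G V :=
  Quotient.map' (fun d => d.fst) (by
    rintro _ d ⟨g, rfl⟩
    exact ⟨g, rfl⟩)

/-- The terminal vertex `e₊` in the quotient graph. -/
def QuotEdge.term : QuotEdge G T → QuotVertex G V :=
  Quotient.map' (fun d => d.snd) (by
    rintro _ d ⟨g, rfl⟩
    exact ⟨g, rfl⟩)

variable (G T)

/-- The choices made to describe the action through its quotient graph `X`: an orientation `A` of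
`X`, a lift of every vertex `v` of `X` to a vertex `ṽ` of the tree, a lift of every edge `e ∈ A` to
an oriented edge `ẽ` of the tree, and elements `t e` of `G`, such that `ẽ₊ = (e₊)~` and
`ẽ₋ = (t e)⁻¹ (e₋)~`.

The choices that come from a maximal tree of `X` lifted to the tree (with `t e = 1` on the
maximal tree) are of this kind; no maximal tree is needed to define the groups and the map below. -/
structure QuotientLift where
  /-- the orientation: exactly one edge of every pair of opposite edges of `X` -/
  A : Set (QuotEdge G T)
  orientation : ∀ e : QuotEdge G T, Xor (e ∈ A) (e.opp ∈ A)
  /-- the lifts of the vertices -/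
  vertexLift : QuotVertex G V → V
  vertexLift_mk : ∀ x : QuotVertex G V, Quotient.mk'' (vertexLift x) = x
  /-- the lifts of the edges in `A` -/
  edgeLift : A → T.Dart
  edgeLift_mk : ∀ e : A, Quotient.mk'' (edgeLift e) = (e : QuotEdge G T)
  /-- the elements `t e` -/
  t : A → G
  edgeLift_term : ∀ e : A, (edgeLift e).snd = vertexLift (e : QuotEdge G T).term
  edgeLift_init : ∀ e : A, (edgeLift e).fst = (t e)⁻¹ • vertexLift (e : QuotEdge G T).init

namespace QuotientLift

variable {G T}
variable (D : QuotientLift G T)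

/-- The vertex group `G_v`: the stabilizer of the lift of `v`. -/
def vertexGroup (x : QuotVertex G V) : Subgroup G := MulAction.stabilizer G (D.vertexLift x)

/-- The edge group `G_e`: the stabilizer of the lift of `e`. -/
def edgeGroup (e : D.A) : Subgroup G := MulAction.stabilizer G (D.edgeLift e)

lemma edgeGroup_le_term (e : D.A) :
    D.edgeGroup e ≤ D.vertexGroup (e : QuotEdge G T).term := by
  intro g hg
  have h : g • D.edgeLift e = D.edgeLift e := hg
  have h2 : g • (D.edgeLift e).snd = (D.edgeLift e).snd :=
    congrArg (fun d : T.Dart => d.snd) h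
  rw [D.edgeLift_term e] at h2
  exact h2

lemma conj_mem_init (e : D.A) {g : G} (hg : g ∈ D.edgeGroup e) :
    D.t e * g * (D.t e)⁻¹ ∈ D.vertexGroup (e : QuotEdge G T).init := by
  have h : g • D.edgeLift e = D.edgeLift e := hg
  have h2 : g • (D.edgeLift e).fst = (D.edgeLift e).fst :=
    congrArg (fun d : T.Dart => d.fst) h
  rw [D.edgeLift_init e] at h2
  change (D.t e * g * (D.t e)⁻¹) • D.vertexLift (e : QuotEdge G T).init = _
  rw [mul_smul, mul_smul, h2, smul_inv_smul]

variable [TopologicalSpace G] {M : Type w} [NormedAddCommGroup M] [InnerProductSpace ℂ M]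

/-- The map `ι : ∏_{v} M^{G_v} → ∏_{e ∈ A} M^{G_e}` of the Mayer-Vietoris sequence,
`(ι f)_e = f_{e₊} - t_e⁻¹ f_{e₋}`. -/
def iota (π : UnitaryRep G M) :
    (∀ x : QuotVertex G V, π.fixed (D.vertexGroup x)) →ₗ[ℂ]
      (∀ e : D.A, π.fixed (D.edgeGroup e)) where
  toFun f e :=
    ⟨(f (e : QuotEdge G T).term : M) - π.toHom (D.t e)⁻¹ (f (e : QuotEdge G T).init : M), by
      intro g hg
      have h1 := (f (e : QuotEdge G T).term).2 g (D.edgeGroup_le_term e hg)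
      have h2 := (f (e : QuotEdge G T).init).2 _ (D.conj_mem_init e hg)
      rw [map_sub, h1]
      congr 1
      conv_rhs => rw [← h2]
      simp only [map_mul, map_inv, LinearIsometryEquiv.coe_mul, Function.comp_apply,
        LinearIsometryEquiv.inv_def, LinearIsometryEquiv.symm_apply_apply]⟩
  map_add' f f' := by
    funext e
    apply Subtype.ext
    simp only [Pi.add_apply, Submodule.coe_add, map_add]
    abel
  map_smul' c f := by
    funext e
    apply Subtype.ext
    simp only [Pi.smul_apply, Submodule.coe_smul, map_smul, RingHom.id_apply, smul_sub]

end QuotientLift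

end Action

/-! Call `m : V → M` equivariant for a cocycle `b` if it intertwines the action on vertices with the
affine action `x ↦ g x + b g`. Its differential along edges is then equivariant, so it amounts to a
point of `∏ M^{G_e}`, and the image of `ι` consists of the differentials with `b = 0`
(`mem_range_iota_iff`). On a tree every point of the product integrates to some `m`, unique up to a
constant, which has its own cocycle (`exists_diff_eq`); adding a constant changes that cocycle by a
coboundary. Conversely every `b` has such an `m`, because by Delorme's theorem the affine action of
each vertex group has a fixed point. Hence the cokernel of `ι` is `H¹`, which gives (i).

For (ii) this correspondence is made quantitative. If the differential of `m` is small, `m` varies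
little along finite paths; a compact set moves a base vertex to finitely many vertices only, so `b`
is uniformly close to a coboundary there. Conversely, the fixed point of a vertex group can be
bounded by the size of `b` on a Kazhdan set, so a small cocycle has an `m` that is small at each
lifted vertex. The product topology asks for no uniformity over the vertices.

Delorme's theorem comes from Gaussian kernels: the affine action preserves `exp (-t‖x - y‖²)`, hence
acts unitarily on the Hilbert space of this kernel. For small `t` the vector at the origin is almost
invariant, Property (T) keeps its whole orbit near it, so `b` is bounded, and the circumcenter of
its values is a fixed point. -/

open scoped ComplexOrder Matrix InnerProductSpace
open Filter Topology

/-! ### Kernels of positive type and their unitary representations -/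

/-- Gram matrices of infinite families are positive semidefinite. -/
theorem Matrix.posSemidef_gram_family {X E : Type*} [NormedAddCommGroup E] [InnerProductSpace ℂ E]
    (v : X → E) : (Matrix.gram ℂ v).PosSemidef := by
  refine ⟨Matrix.isHermitian_gram ℂ v, fun x => ?_⟩
  have h : (0 : ℂ) ≤ inner ℂ (x.sum fun i c => c • v i) (x.sum fun i c => c • v i) := by
    rw [inner_self_eq_norm_sq_to_K]
    positivity
  refine h.trans_eq ?_
  rw [Finsupp.sum_inner]
  simp only [Finsupp.sum, inner_sum, inner_smul_left, inner_smul_right, Matrix.gram_apply]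
  refine Finset.sum_congr rfl fun i _ => Finset.sum_congr rfl fun j _ => ?_
  simp only [RCLike.star_def]
  ring

/-- The entrywise exponential of a positive semidefinite matrix is positive semidefinite. -/
theorem Matrix.PosSemidef.map_exp {X : Type*} {A : Matrix X X ℂ} (hA : A.PosSemidef) :
    (Matrix.of fun i j => Complex.exp (A i j)).PosSemidef := by
  -- Schur's product theorem handles the entrywise powers; the exponential is a limit of their
  -- nonnegative combinations.
  have hpow : ∀ n : ℕ, (Matrix.of fun i j => A i j ^ n).PosSemidef := by
    intro n
    induction n with
    | zero =>
      have h := Matrix.posSemidef_gram_family (fun _ : X => (1 : ℂ))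
      have e : (Matrix.of fun i j => A i j ^ 0) = Matrix.gram ℂ (fun _ : X => (1 : ℂ)) := by
        ext i j
        simp
      rw [e]
      exact h
    | succ n ih =>
      exact ih.hadamard hA
  have hsum : ∀ N : ℕ,
      (∑ n ∈ Finset.range N, ((n.factorial : ℂ)⁻¹) • Matrix.of fun i j => A i j ^ n).PosSemidef :=
    fun N => Matrix.posSemidef_sum _ fun n _ => (hpow n).smul (by positivity)
  refine ⟨?_, fun x => ?_⟩
  · ext i j
    have h := hA.isHermitian.apply i j
    simp only [Matrix.conjTranspose_apply, Matrix.of_apply]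
    rw [← h]
    simp [← Complex.exp_conj]
  · refine ge_of_tendsto' (x := atTop) (f := fun N : ℕ => _) ?_ (fun N => (hsum N).2 x)
    refine tendsto_finsetSum _ fun i _ => tendsto_finsetSum _ fun j _ => ?_
    refine Tendsto.mul_const _ (Tendsto.const_mul _ ?_)
    simp only [Matrix.sum_apply, Matrix.smul_apply, Matrix.of_apply]
    have h := (NormedSpace.expSeries_div_hasSum_exp (A i j)).tendsto_sum_nat
    rw [← Complex.exp_eq_exp_ℂ] at h
    refine h.congr fun N => Finset.sum_congr rfl fun n _ => ?_
    simp [div_eq_inv_mul]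

/-- The Gaussian kernel `exp (-t‖x - y‖²)` of a Hilbert space. -/
noncomputable def gaussianKernel (M : Type*) [NormedAddCommGroup M] (t : ℝ) : Matrix M M ℂ :=
  Matrix.of fun x y => (Real.exp (-(t * ‖x - y‖ ^ 2)) : ℂ)

/-- The Gaussian kernel of a Hilbert space is of positive type. -/
theorem posSemidef_gaussianKernel {M : Type*} [NormedAddCommGroup M] [InnerProductSpace ℂ M]
    {t : ℝ} (ht : 0 ≤ t) : (gaussianKernel M t).PosSemidef := by
  -- The kernel factors as `exp (2t Re⟨x, y⟩)` times the rank-one kernel `exp (-t‖x‖²) exp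
  -- (-t‖y‖²)`; Gram matrix plus transpose produces the real part.
  have h1 := Matrix.posSemidef_gram_family (fun x : M => x)
  have h2 := ((h1.add h1.transpose).smul (a := (t : ℂ)) (by simpa using ht)).map_exp
  have h3 := Matrix.posSemidef_gram_family
    (fun x : M => (Real.exp (-(t * ‖x‖ ^ 2)) : ℂ))
  refine (congrArg Matrix.PosSemidef (Matrix.ext fun x y => ?_)).mpr (h2.hadamard h3)
  simp only [gaussianKernel, Matrix.of_apply, Matrix.hadamard_apply, Matrix.smul_apply,
    Matrix.add_apply, Matrix.gram_apply, Matrix.transpose_apply, smul_eq_mul, RCLike.inner_apply,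
    Complex.conj_ofReal]
  have h4 : inner ℂ x y + inner ℂ y x = ((2 * RCLike.re (inner ℂ x y) : ℝ) : ℂ) := by
    rw [← inner_conj_symm y x, RCLike.add_conj]
    simp
  rw [h4, norm_sub_sq (𝕜 := ℂ)]
  norm_cast
  rw [← Real.exp_add, ← Real.exp_add]
  congr 1
  ring

/-- A kernel of positive type on `X` is the Gram matrix of a total family in a Hilbert space. -/
theorem Matrix.PosSemidef.exists_hilbert {X : Type w} {k : Matrix X X ℂ} (hk : k.PosSemidef) :
    ∃ (H : Type w) (_ : NormedAddCommGroup H) (_ : InnerProductSpace ℂ H) (_ : CompleteSpace H)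
      (δ : X → H), (∀ x y, inner ℂ (δ x) (δ y) = k x y) ∧
        DenseRange (Finsupp.linearCombination ℂ δ) := by
  let K : Matrix X X (ℂ →L[ℂ] ℂ) := Matrix.of fun x y => k x y • ContinuousLinearMap.id ℂ ℂ
  have hK : K.PosSemidef := by
    refine (RKHS.posSemidef_tfae.out 0 2).mpr (And.intro ?_ fun f => ?_)
    · ext x y
      have h := hk.isHermitian.apply x y
      simp only [Matrix.conjTranspose_apply, K, Matrix.of_apply, star_smul]
      rw [h]
      simp [ContinuousLinearMap.star_eq_adjoint, ContinuousLinearMap.adjoint_id]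
    · have h := (Complex.le_def.mp (hk.2 f)).1
      refine h.trans_eq ?_
      rw [RCLike.re_eq_complex_re]
      congr 1
      refine Finsupp.sum_congr fun x _ => Finsupp.sum_congr fun y _ => ?_
      have h := hk.isHermitian.apply x y
      simp only [K, Matrix.of_apply, _root_.smul_apply, ContinuousLinearMap.id_apply,
        smul_eq_mul, RCLike.inner_apply, map_mul]
      rw [← h]
      simp only [RCLike.star_def]
      ring
  have : Fact K.PosSemidef := ⟨hK⟩
  refine ⟨RKHS.OfKernel K, inferInstance, inferInstance, inferInstance,
    fun x => RKHS.kerFun (RKHS.OfKernel K) x 1, fun x y => ?_, ?_⟩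
  · rw [← RKHS.kernel_inner, RKHS.OfKernel.kernel_ofKernel]
    have h := hk.isHermitian.apply x y
    simp only [K, Matrix.of_apply, _root_.smul_apply, ContinuousLinearMap.id_apply,
        smul_eq_mul, RCLike.inner_apply, map_mul]
    rw [← h]
    simp
  · have h := RKHS.kerFun_dense (RKHS.OfKernel K)
    rw [← Submodule.dense_iff_topologicalClosure_eq_top] at h
    refine h.mono ?_
    rw [← LinearMap.coe_range, Finsupp.range_linearCombination]
    refine Submodule.span_le.mpr ?_
    rintro _ ⟨x, v, rfl⟩
    have e : RKHS.kerFun (RKHS.OfKernel K) x v = v • RKHS.kerFun (RKHS.OfKernel K) x 1 := by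
      rw [← map_smul, smul_eq_mul, mul_one]
    rw [e]
    exact Submodule.smul_mem _ _ (Submodule.subset_span ⟨x, rfl⟩)

/-- A group action preserving a kernel of positive type is unitarily represented on the Hilbert
space of the kernel. -/
theorem Matrix.PosSemidef.exists_unitaryRep {G : Type u} [Group G] [TopologicalSpace G]
    {X : Type w} {k : Matrix X X ℂ} (hk : k.PosSemidef) (φ : G →* Equiv.Perm X)
    (hφ : ∀ g x y, k (φ g x) (φ g y) = k x y)
    (hc : ∀ x y, Continuous fun g => k y (φ g x)) :
    ∃ (H : Type w) (_ : NormedAddCommGroup H) (_ : InnerProductSpace ℂ H) (_ : CompleteSpace H)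
      (π : UnitaryRep G H) (δ : X → H), (∀ x y, inner ℂ (δ x) (δ y) = k x y) ∧
        ∀ g x, π.toHom g (δ x) = δ (φ g x) := by
  obtain ⟨H, i1, i2, i3, δ, hδ, hd⟩ := hk.exists_hilbert
  have hinner : ∀ (a : X →₀ ℂ) (y : X → X), (∀ i j, k (y i) (y j) = k i j) →
      inner ℂ (Finsupp.linearCombination ℂ (δ ∘ y) a) (Finsupp.linearCombination ℂ (δ ∘ y) a) =
      a.sum fun i c => a.sum fun j d => starRingEnd ℂ c * (d * k i j) := by
    intro a y hy
    simp only [Finsupp.linearCombination_apply, Finsupp.sum_inner]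
    simp only [Finsupp.sum, inner_sum, inner_smul_left, inner_smul_right, Function.comp_apply,
      hδ, hy]
    exact Finset.sum_congr rfl fun i _ => Finset.sum_congr rfl fun j _ => mul_left_comm _ _ _
  have hn : ∀ (g : G) (a : X →₀ ℂ), ‖Finsupp.linearCombination ℂ δ
      (Finsupp.domLCongr (R := ℂ) (M := ℂ) (φ g) a)‖ = ‖Finsupp.linearCombination ℂ δ a‖ := by
    intro g a
    have e : Finsupp.linearCombination ℂ δ (Finsupp.domLCongr (R := ℂ) (M := ℂ) (φ g) a) =
        Finsupp.linearCombination ℂ (δ ∘ φ g) a := by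
      rw [Finsupp.domLCongr_apply, Finsupp.domCongr_apply, Finsupp.equivMapDomain_eq_mapDomain,
        Finsupp.linearCombination_mapDomain]
    rw [e, @norm_eq_sqrt_re_inner ℂ, @norm_eq_sqrt_re_inner ℂ, hinner a (φ g) (hφ g)]
    have h := hinner a id fun _ _ => rfl
    rw [Function.comp_id] at h
    rw [h]
  let U : G → (H ≃ₗᵢ[ℂ] H) := fun g =>
    (Finsupp.domLCongr (R := ℂ) (M := ℂ) (φ g)).extendOfIsometry (Finsupp.linearCombination ℂ δ)
      (Finsupp.linearCombination ℂ δ) hd hd (hn g)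
  have hU : ∀ g x, U g (δ x) = δ (φ g x) := by
    intro g x
    have h := LinearEquiv.extendOfIsometry_eq (Finsupp.domLCongr (R := ℂ) (M := ℂ) (φ g))
      (Finsupp.linearCombination ℂ δ) (Finsupp.linearCombination ℂ δ) hd hd (hn g)
      (Finsupp.single x 1)
    simpa [Finsupp.domLCongr_single] using h
  have hspan : Dense (Submodule.span ℂ (Set.range δ) : Set H) := by
    rw [← Finsupp.range_linearCombination, LinearMap.coe_range]
    exact hd
  have hext : ∀ A B : H →L[ℂ] H, (∀ x, A (δ x) = B (δ x)) → A = B := by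
    intro A B h
    refine ContinuousLinearMap.ext_on hspan ?_
    rintro _ ⟨x, rfl⟩
    exact h x
  let Φ : G →* (H ≃ₗᵢ[ℂ] H) := MonoidHom.mk' U fun g h => by
    have e := hext (U (g * h)).toContinuousLinearEquiv
      (U g * U h : H ≃ₗᵢ[ℂ] H).toContinuousLinearEquiv (fun x => by
        change U (g * h) (δ x) = U g (U h (δ x))
        rw [hU, hU, hU, map_mul]; rfl)
    ext m
    exact DFunLike.congr_fun e m
  have hΦ : ∀ g x, Φ g (δ x) = δ (φ g x) := hU
  -- Vectors with continuous orbit map form a subspace containing every `δ x`, hence a dense one;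
  -- isometry makes approximation uniform in `g`, which reaches all vectors.
  let S : Submodule ℂ H :=
    { carrier := {m | Continuous fun g => Φ g m}
      zero_mem' := by simpa using continuous_const
      add_mem' := fun ha hb => by simpa using Continuous.fun_add ha hb
      smul_mem' := fun c a ha => by simpa using Continuous.fun_const_smul ha c }
  have hSδ : ∀ x, δ x ∈ S := by
    intro x
    change Continuous fun g => Φ g (δ x)
    simp only [hΦ]
    refine continuous_iff_continuousAt.mpr fun g₀ => ?_
    refine tendsto_iff_norm_sub_tendsto_zero.mpr ?_
    have hsq : ∀ g, ‖δ (φ g x) - δ (φ g₀ x)‖ ^ 2 =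
        2 * (k x x).re - 2 * (k (φ g₀ x) (φ g x)).re := by
      intro g
      have hnn : ∀ y, ‖δ y‖ ^ 2 = (k y y).re := fun y => by
        rw [← hδ, @norm_sq_eq_re_inner ℂ]; rfl
      rw [norm_sub_rev, @norm_sub_sq ℂ, hnn, hnn, hφ, hφ, hδ, RCLike.re_eq_complex_re]
      ring
    have hlim : Tendsto (fun g => ‖δ (φ g x) - δ (φ g₀ x)‖ ^ 2) (𝓝 g₀) (𝓝 0) := by
      simp only [hsq]
      have h := (continuous_const (y := 2 * (k x x).re)).fun_sub
        ((Complex.continuous_re.comp (hc x (φ g₀ x))).const_mul 2) |>.tendsto g₀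
      simpa [hφ] using h
    have h := (Real.continuous_sqrt.tendsto 0).comp hlim
    simpa [Function.comp_def, Real.sqrt_sq (norm_nonneg _)] using h
  refine ⟨H, i1, i2, i3, ⟨Φ, fun m => ?_⟩, δ, hδ, hΦ⟩
  refine continuous_of_uniform_approx_of_continuous fun u hu => ?_
  obtain ⟨ε, hε, hu⟩ := Metric.mem_uniformity_dist.mp hu
  obtain ⟨n, hnS, hmn⟩ := hspan.exists_dist_lt m hε
  refine ⟨fun g => Φ g n, Submodule.span_le.mpr (by rintro _ ⟨x, rfl⟩; exact hSδ x) hnS,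
    fun g => hu ?_⟩
  rw [(Φ g).dist_map]
  exact hmn

/-! ### Invariant vectors and Kazhdan pairs -/

namespace UnitaryRep

variable {G : Type u} [Group G] [TopologicalSpace G]
  {M : Type w} [NormedAddCommGroup M] [InnerProductSpace ℂ M]

theorem mul_apply (π : UnitaryRep G M) (g h : G) (m : M) :
    π.toHom (g * h) m = π.toHom g (π.toHom h m) := by
  rw [map_mul]; rfl

theorem one_apply (π : UnitaryRep G M) (m : M) : π.toHom 1 m = m := by
  rw [map_one]; rfl

theorem inv_apply_self (π : UnitaryRep G M) (g : G) (m : M) :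
    π.toHom g⁻¹ (π.toHom g m) = m := by
  rw [← mul_apply, inv_mul_cancel, one_apply]

theorem apply_inv_self (π : UnitaryRep G M) (g : G) (m : M) :
    π.toHom g (π.toHom g⁻¹ m) = m := by
  rw [← mul_apply, mul_inv_cancel, one_apply]

/-- The restriction of a unitary representation to an invariant subspace. -/
noncomputable def subrep (π : UnitaryRep G M) (F : Submodule ℂ M)
    (hF : ∀ g, ∀ m ∈ F, π.toHom g m ∈ F) : UnitaryRep G F where
  toHom := MonoidHom.mk' (fun g =>
    { toFun := fun m => ⟨π.toHom g m, hF g m m.2⟩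
      invFun := fun m => ⟨π.toHom g⁻¹ m, hF g⁻¹ m m.2⟩
      map_add' := fun a b => Subtype.ext (map_add (π.toHom g) (a : M) b)
      map_smul' := fun c a => Subtype.ext (map_smul (π.toHom g) c (a : M))
      left_inv := fun m => Subtype.ext (π.inv_apply_self g m)
      right_inv := fun m => Subtype.ext (π.apply_inv_self g m)
      norm_map' := fun m => (π.toHom g).norm_map m }) fun g h => by
    ext m
    exact π.mul_apply g h m
  strongly_continuous m := (π.strongly_continuous m).subtype_mk _

/-- The restriction of a unitary representation to a subgroup. -/
def restrict (π : UnitaryRep G M) (K : Subgroup G) : UnitaryRep K M where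
  toHom := π.toHom.comp K.subtype
  strongly_continuous m := (π.strongly_continuous m).comp continuous_subtype_val

theorem orthogonal_fixed_invariant (π : UnitaryRep G M) (g : G) {m : M}
    (hm : m ∈ (π.fixed ⊤)ᗮ) : π.toHom g m ∈ (π.fixed ⊤)ᗮ := by
  rw [Submodule.mem_orthogonal] at hm ⊢
  intro n hn
  have h : π.toHom g n = n := hn g trivial
  rw [← h, LinearIsometryEquiv.inner_map_map]
  exact hm n hn

theorem isClosed_fixed (π : UnitaryRep G M) (H : Subgroup G) :
    IsClosed (π.fixed H : Set M) := by
  have e : (π.fixed H : Set M) = ⋂ h ∈ H, {m | π.toHom h m = m} := by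
    ext m
    simp [fixed]
  rw [e]
  exact isClosed_biInter fun h _ => isClosed_eq (π.toHom h).continuous continuous_id

/-- The decomposition of a vector into an invariant vector and a vector orthogonal to all
invariant ones. -/
theorem exists_fixed_add_orthogonal [CompleteSpace M] (π : UnitaryRep G M) (m : M) :
    ∃ p ∈ π.fixed ⊤, ∃ q ∈ (π.fixed ⊤)ᗮ, m = p + q := by
  have : CompleteSpace (π.fixed ⊤) := (π.isClosed_fixed ⊤).completeSpace_coe
  obtain ⟨p, hp, q, hq, h⟩ := (π.fixed ⊤).exists_add_mem_mem_orthogonal m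
  exact ⟨p, hp, q, hq, h⟩

end UnitaryRep

/-- `(Q, ε)` is a Kazhdan pair of `G`, for representations in the universe `w`. -/
def IsKazhdanPair (G : Type u) [Group G] [TopologicalSpace G] (Q : Set G) (ε : ℝ) : Prop :=
  ∀ (H : Type w) [NormedAddCommGroup H] [InnerProductSpace ℂ H] [CompleteSpace H]
    (π : UnitaryRep G H), ∀ ξ ∈ (π.fixed ⊤)ᗮ, ∀ r : ℝ, 0 ≤ r →
      (∀ g ∈ Q, ‖π.toHom g ξ - ξ‖ ≤ r) → ε * ‖ξ‖ ≤ r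

theorem HasPropertyT.exists_isKazhdanPair {G : Type u} [Group G] [TopologicalSpace G]
    (hT : HasPropertyT.{u, w} G) :
    ∃ Q : Set G, IsCompact Q ∧ ∃ ε : ℝ, 0 < ε ∧ IsKazhdanPair.{u, w} G Q ε := by
  obtain ⟨Q, hQ, ε, hε, h⟩ := hT
  refine ⟨Q, hQ, ε, hε, fun H _ _ _ π ξ hξ r hr hξr => ?_⟩
  by_contra! hlt
  have hξ0 : ξ ≠ 0 := by
    rintro rfl
    simp at hlt
    linarith
  -- Property (T) is applied to the complement of the invariant vectors; an invariant vector found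
  -- there is orthogonal to itself.
  obtain ⟨η, hη0, hη⟩ := h _ (π.subrep (π.fixed ⊤)ᗮ fun g m => π.orthogonal_fixed_invariant g)
    ⟨⟨ξ, hξ⟩, fun h0 => hξ0 (congrArg Subtype.val h0), fun g hg => (hξr g hg).trans_lt hlt⟩
  refine hη0 (Subtype.ext ?_)
  have h1 : (η : H) ∈ π.fixed ⊤ := fun g _ => congrArg Subtype.val (hη g)
  exact inner_self_eq_zero.mp ((Submodule.mem_orthogonal _ _).mp η.2 η h1)

/-! ### Circumcenters in Hilbert spaces -/

/-- A nonnegative, continuous, uniformly convex function on a Banach space has a unique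
minimizer. -/
theorem existsUnique_forall_le_of_uniformConvex {M : Type*} [NormedAddCommGroup M]
    [NormedSpace ℝ M] [CompleteSpace M] {f : M → ℝ} (hf : Continuous f) (h0 : ∀ x, 0 ≤ f x)
    (hconv : ∀ x y, f ((1 / 2 : ℝ) • (x + y)) ≤ (f x + f y) / 2 - ‖x - y‖ ^ 2 / 4) :
    ∃! c, ∀ x, f c ≤ f x := by
  have hbdd : BddBelow (Set.range f) := ⟨0, by rintro _ ⟨x, rfl⟩; exact h0 x⟩
  set R := ⨅ x, f x with hR
  have hRle : ∀ x, R ≤ f x := fun x => ciInf_le hbdd x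
  -- The value at the midpoint is at least `R`, so almost-minimizers lie close together: this gives
  -- both the Cauchy property and uniqueness.
  have key : ∀ x y, ‖x - y‖ ^ 2 ≤ 2 * (f x - R) + 2 * (f y - R) := fun x y => by
    linarith [hconv x y, hRle ((1 / 2 : ℝ) • (x + y))]
  have hex : ∀ n : ℕ, ∃ x, f x < R + 1 / ((n : ℝ) + 1) := fun n =>
    exists_lt_of_ciInf_lt (lt_add_of_pos_right _ Nat.one_div_pos_of_nat)
  choose x hx using hex
  have hlim0 := tendsto_one_div_add_atTop_nhds_zero_nat (𝕜 := ℝ)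
  have hcau : CauchySeq x := by
    refine cauchySeq_of_le_tendsto_0 (fun n : ℕ => √(4 * (1 / ((n : ℝ) + 1)))) ?_ ?_
    · intro n m N hn hm
      rw [dist_eq_norm]
      refine Real.le_sqrt_of_sq_le ?_
      have h1 : 1 / ((n : ℝ) + 1) ≤ 1 / ((N : ℝ) + 1) := Nat.one_div_le_one_div hn
      have h2 : 1 / ((m : ℝ) + 1) ≤ 1 / ((N : ℝ) + 1) := Nat.one_div_le_one_div hm
      linarith [key (x n) (x m), hx n, hx m]
    · have h := (Real.continuous_sqrt.tendsto _).comp (hlim0.const_mul 4)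
      simpa [Function.comp_def] using h
  obtain ⟨c, hc⟩ := cauchySeq_tendsto_of_complete hcau
  have hfc : f c ≤ R := by
    refine le_of_tendsto_of_tendsto ((hf.tendsto c).comp hc)
      (by simpa using hlim0.const_add R) (Eventually.of_forall fun n => (hx n).le)
  refine ⟨c, fun y => hfc.trans (hRle y), fun y hy => ?_⟩
  have h1 := key y c
  have h2 := hy c
  have h3 : ‖y - c‖ ^ 2 ≤ 0 := by linarith
  rw [← sub_eq_zero, ← norm_eq_zero]
  exact pow_eq_zero_iff two_ne_zero |>.mp (le_antisymm h3 (sq_nonneg _))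

/-- A bounded family in a Hilbert space has a unique circumcenter. -/
theorem existsUnique_circumcenter {M ι : Type*} [NormedAddCommGroup M] [InnerProductSpace ℂ M]
    [CompleteSpace M] [Nonempty ι] (b : ι → M) {C : ℝ} (hC : ∀ i, ‖b i‖ ≤ C) :
    ∃! c, ∀ x, (⨆ i, ‖c - b i‖ ^ 2) ≤ ⨆ i, ‖x - b i‖ ^ 2 := by
  let _ : InnerProductSpace ℝ M := InnerProductSpace.rclikeToReal ℂ M
  have hbd : ∀ x, BddAbove (Set.range fun i => ‖x - b i‖ ^ 2) := fun x => by
    refine ⟨(‖x‖ + C) ^ 2, ?_⟩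
    rintro _ ⟨i, rfl⟩
    exact pow_le_pow_left₀ (norm_nonneg _) ((norm_sub_le _ _).trans (by linarith [hC i])) 2
  have hle : ∀ x i, ‖x - b i‖ ^ 2 ≤ ⨆ i, ‖x - b i‖ ^ 2 := fun x i => le_ciSup (hbd x) i
  refine existsUnique_forall_le_of_uniformConvex ?_
    (fun x => Real.iSup_nonneg fun i => sq_nonneg _) fun x y => ciSup_le fun i => ?_
  · have hC0 : 0 ≤ C := (norm_nonneg _).trans (hC (Classical.arbitrary ι))
    have hstep : ∀ x y, (⨆ i, ‖x - b i‖ ^ 2) ≤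
        (⨆ i, ‖y - b i‖ ^ 2) + ‖x - y‖ * (‖x - y‖ + 2 * (‖y‖ + C)) := by
      intro x y
      refine ciSup_le fun i => ?_
      have h1 : ‖x - b i‖ ≤ ‖y - b i‖ + ‖x - y‖ := by
        have := norm_add_le (y - b i) (x - y)
        rwa [show y - b i + (x - y) = x - b i by abel] at this
      have h2 : ‖y - b i‖ ≤ ‖y‖ + C := (norm_sub_le _ _).trans (by linarith [hC i])
      have h3 := pow_le_pow_left₀ (norm_nonneg _) h1 2
      nlinarith [hle y i, norm_nonneg (x - y)]
    refine continuous_iff_continuousAt.mpr fun y => ?_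
    have hn : Tendsto (fun x => ‖x - y‖) (𝓝 y) (𝓝 0) := by
      simpa using (continuous_id.sub continuous_const).norm.tendsto (f := fun x => ‖x - y‖) y
    have hu : Tendsto (fun x => (⨆ i, ‖y - b i‖ ^ 2) + ‖x - y‖ * (‖x - y‖ + 2 * (‖y‖ + C)))
        (𝓝 y) (𝓝 (⨆ i, ‖y - b i‖ ^ 2)) := by
      simpa using (hn.mul (hn.add_const (2 * (‖y‖ + C)))).const_add (⨆ i, ‖y - b i‖ ^ 2)
    have hl : Tendsto (fun x => (⨆ i, ‖y - b i‖ ^ 2) - ‖x - y‖ * (‖x - y‖ + 2 * (‖x‖ + C)))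
        (𝓝 y) (𝓝 (⨆ i, ‖y - b i‖ ^ 2)) := by
      simpa using (hn.mul (hn.add (((continuous_norm.tendsto y).add_const C).const_mul
        2))).const_sub (⨆ i, ‖y - b i‖ ^ 2)
    refine tendsto_of_tendsto_of_tendsto_of_le_of_le hl hu (fun x => ?_) (fun x => hstep x y)
    have h := hstep y x
    rw [norm_sub_rev y x] at h
    simp only
    linarith
  -- Uniform convexity is the parallelogram law for each `i`, and it survives the supremum.
  · have hpar := parallelogram_law_with_norm ℝ (x - b i) (y - b i)
    rw [show x - b i + (y - b i) = (2 : ℝ) • ((1 / 2 : ℝ) • (x + y) - b i) by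
      rw [smul_sub, smul_smul, two_smul ℝ (b i)]; norm_num; abel, norm_smul,
      show x - b i - (y - b i) = x - y by abel] at hpar
    rw [Real.norm_ofNat] at hpar
    nlinarith [hle x i, hle y i, hpar]

/-! ### Affine isometric actions and Delorme's theorem -/

namespace UnitaryRep

variable {G : Type u} [Group G] [TopologicalSpace G]
  {M : Type w} [NormedAddCommGroup M] [InnerProductSpace ℂ M]

theorem Z1.map_mul {π : UnitaryRep G M} (b : π.Z1) (g h : G) :
    (b : C(G, M)) (g * h) = (b : C(G, M)) g + π.toHom g ((b : C(G, M)) h) := b.2 g h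

theorem Z1.map_one {π : UnitaryRep G M} (b : π.Z1) : (b : C(G, M)) 1 = 0 := by
  have h := Z1.map_mul b 1 1
  rw [mul_one, one_apply] at h
  simpa using h

/-- The affine isometric action `x ↦ g x + b g` given by a cocycle `b`. -/
def affineAction (π : UnitaryRep G M) (b : π.Z1) : G →* Equiv.Perm M where
  toFun g :=
    { toFun := fun x => π.toHom g x + (b : C(G, M)) g
      invFun := fun x => π.toHom g⁻¹ x + (b : C(G, M)) g⁻¹
      left_inv := fun x => by
        have h := Z1.map_mul b g⁻¹ g
        rw [inv_mul_cancel, Z1.map_one] at h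
        simp only [map_add, inv_apply_self]
        rw [add_assoc, add_comm (π.toHom _ _), ← h, add_zero]
      right_inv := fun x => by
        have h := Z1.map_mul b g g⁻¹
        rw [mul_inv_cancel, Z1.map_one] at h
        simp only [map_add, apply_inv_self]
        rw [add_assoc, add_comm (π.toHom _ _), ← h, add_zero] }
  map_one' := by
    ext x
    simp [Z1.map_one]
  map_mul' g h := by
    ext x
    simp [Z1.map_mul]
    abel

theorem affineAction_apply (π : UnitaryRep G M) (b : π.Z1) (g : G) (x : M) :
    π.affineAction b g x = π.toHom g x + (b : C(G, M)) g := rfl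

theorem norm_affineAction_sub (π : UnitaryRep G M) (b : π.Z1) (g : G) (x y : M) :
    ‖π.affineAction b g x - π.affineAction b g y‖ = ‖x - y‖ := by
  rw [affineAction_apply, affineAction_apply, add_sub_add_right_eq_sub, ← map_sub,
    LinearIsometryEquiv.norm_map]

theorem affineAction_zero (π : UnitaryRep G M) (b : π.Z1) (g : G) :
    π.affineAction b g 0 = (b : C(G, M)) g := by
  simp [affineAction_apply]

/-- A bounded cocycle is a coboundary. -/
theorem exists_eq_sub_of_bounded [CompleteSpace M] (π : UnitaryRep G M) (b : π.Z1) {C : ℝ}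
    (hC : ∀ g, ‖(b : C(G, M)) g‖ ≤ C) : ∃ m, ∀ g, (b : C(G, M)) g = π.toHom g m - m := by
  obtain ⟨c, hc, huniq⟩ := existsUnique_circumcenter (fun g => (b : C(G, M)) g) hC
  -- The values of `b` form the affine orbit of `0`, so by uniqueness their circumcenter `c` is
  -- fixed: `c = g c + b g`, whence the witness `-c`.
  have hinv : ∀ g x, (⨆ h, ‖π.affineAction b g x - (b : C(G, M)) h‖ ^ 2) =
      ⨆ h, ‖x - (b : C(G, M)) h‖ ^ 2 := by
    intro g x
    rw [← (Equiv.mulLeft g).iSup_comp]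
    congr 1
    ext h
    simp only [Equiv.coe_mulLeft]
    rw [← affineAction_zero, _root_.map_mul, Equiv.Perm.mul_apply, norm_affineAction_sub,
      affineAction_zero]
  refine ⟨-c, fun g => ?_⟩
  have h := huniq (π.affineAction b g c) fun x => (hinv g c).trans_le (hc x)
  rw [affineAction_apply] at h
  rw [map_neg, sub_neg_eq_add, ← sub_eq_neg_add]
  exact eq_sub_of_add_eq' h

/-- **Delorme's theorem**: every cocycle of a group with Property (T) is a coboundary. -/
theorem exists_eq_sub_of_isKazhdanPair [IsTopologicalGroup G] [CompleteSpace M] {Q : Set G}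
    (hQ : IsCompact Q) {ε : ℝ} (hε : 0 < ε) (hK : IsKazhdanPair.{u, w} G Q ε)
    (π : UnitaryRep G M) (b : π.Z1) : ∃ m, ∀ g, (b : C(G, M)) g = π.toHom g m - m := by
  obtain ⟨C, hC⟩ := hQ.exists_bound_of_continuousOn (b : C(G, M)).continuous.continuousOn
  -- On `Q` the squared displacement of `δ 0` is at most `2 t C² ≤ (ε / 2)²`; the `+ 1` keeps the
  -- denominator positive when `C = 0`.
  set t : ℝ := ε ^ 2 / (8 * (C ^ 2 + 1)) with ht
  have ht0 : 0 < t := by positivity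
  obtain ⟨H, _, _, _, σ, δ, hδ, hσ⟩ := (posSemidef_gaussianKernel (M := M)
    ht0.le).exists_unitaryRep (π.affineAction b)
      (fun g x y => by simp only [gaussianKernel, Matrix.of_apply, norm_affineAction_sub])
      (fun x y => by
        have h := π.strongly_continuous x
        have h' := (b : C(G, M)).continuous
        simp only [gaussianKernel, Matrix.of_apply, affineAction_apply]
        fun_prop)
  have hdisp : ∀ g, ‖σ.toHom g (δ 0) - δ 0‖ ^ 2 =
      2 - 2 * Real.exp (-(t * ‖(b : C(G, M)) g‖ ^ 2)) := by
    intro g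
    have hn : ∀ x, ‖δ x‖ ^ 2 = 1 := fun x => by
      rw [@norm_sq_eq_re_inner ℂ, hδ]
      simp [gaussianKernel]
    rw [hσ, affineAction_zero, @norm_sub_sq ℂ, hn, hn, hδ]
    simp only [gaussianKernel, Matrix.of_apply, sub_zero]
    rw [RCLike.re_eq_complex_re, Complex.ofReal_re]
    ring
  obtain ⟨p, hp, q, hq, hpq⟩ := σ.exists_fixed_add_orthogonal (δ 0)
  have hq' : ∀ g, σ.toHom g (δ 0) - δ 0 = σ.toHom g q - q := fun g => by
    have h : σ.toHom g p = p := hp g trivial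
    rw [hpq, map_add, h]
    abel
  have hqn : ε * ‖q‖ ≤ ε / 2 := by
    refine hK H σ q hq _ (by positivity) fun g hg => ?_
    rw [← hq']
    refine (sq_le_sq₀ (norm_nonneg _) (by positivity)).mp ?_
    rw [hdisp]
    have h1 := Real.add_one_le_exp (-(t * ‖(b : C(G, M)) g‖ ^ 2))
    have h2 : ‖(b : C(G, M)) g‖ ^ 2 ≤ C ^ 2 := pow_le_pow_left₀ (norm_nonneg _) (hC g hg) 2
    have h3 : t * (C ^ 2 + 1) = ε ^ 2 / 8 := by
      rw [ht]
      field_simp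
    nlinarith
  have hqn2 : ‖q‖ ≤ 1 / 2 := by
    by_contra! hlt
    nlinarith
  -- As `‖q‖ ≤ 1 / 2`, every displacement of `δ 0` is at most `1`, so `exp (-t‖b g‖²) ≥ 1 / 2 ≥ exp
  -- (-1)`.
  refine π.exists_eq_sub_of_bounded b (C := √(1 / t)) fun g => Real.le_sqrt_of_sq_le ?_
  have h1 : ‖σ.toHom g (δ 0) - δ 0‖ ≤ 1 := by
    rw [hq']
    refine (norm_sub_le _ _).trans ?_
    rw [LinearIsometryEquiv.norm_map]
    linarith
  have h2 := pow_le_pow_left₀ (norm_nonneg _) h1 2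
  rw [hdisp] at h2
  have h3 : Real.exp (-1) ≤ Real.exp (-(t * ‖(b : C(G, M)) g‖ ^ 2)) := by
    have h4 := Real.exp_one_gt_d9
    have h5 : Real.exp (-1) ≤ 1 / 2 := by
      rw [Real.exp_neg, inv_le_comm₀ (Real.exp_pos _) (by norm_num)]
      linarith
    linarith
  have h6 := Real.exp_le_exp.mp h3
  rw [le_div_iff₀ ht0]
  linarith

/-- A cocycle of a group with Property (T) is the coboundary of a vector that is controlled by the
values of the cocycle on a Kazhdan set. -/
theorem exists_norm_le_eq_sub_of_isKazhdanPair [IsTopologicalGroup G] [CompleteSpace M]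
    {Q : Set G} (hQ : IsCompact Q) {ε : ℝ} (hε : 0 < ε) (hK : IsKazhdanPair.{u, w} G Q ε)
    (π : UnitaryRep G M) (b : π.Z1) :
    ∃ m, (∀ r, 0 ≤ r → (∀ g ∈ Q, ‖(b : C(G, M)) g‖ ≤ r) → ε * ‖m‖ ≤ r) ∧
      ∀ g, (b : C(G, M)) g = π.toHom g m - m := by
  obtain ⟨m, hm⟩ := exists_eq_sub_of_isKazhdanPair hQ hε hK π b
  -- The invariant part does not contribute to the coboundary; the Kazhdan pair bounds what remains.
  obtain ⟨p, hp, q, hq, rfl⟩ := π.exists_fixed_add_orthogonal m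
  have h : ∀ g, (b : C(G, M)) g = π.toHom g q - q := fun g => by
    have h : π.toHom g p = p := hp g trivial
    rw [hm, map_add, h]
    abel
  exact ⟨q, fun r hr hb => hK M π q hq r hr fun g hg => h g ▸ hb g hg, h⟩

end UnitaryRep

/-! ### Equivariant functions on orbits, vertices and edges -/

/-- Extension of a function on representatives of orbits to an equivariant function, with constant
value `z` on the remaining orbits. -/
theorem exists_equivariant_extension {G X N I : Type*} [Group G] [MulAction G X]
    (φ : G →* Equiv.Perm N) (s : I → X) (hs : ∀ i j, ∀ g : G, g • s i = s j → i = j) (n : I → N)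
    (hn : ∀ i, ∀ h ∈ MulAction.stabilizer G (s i), φ h (n i) = n i) (z : N) :
    ∃ c : X → N, (∀ (g : G) i, c (g • s i) = φ g (n i)) ∧
      ∀ x, (∀ (g : G) i, x ≠ g • s i) → c x = z := by
  classical
  refine ⟨fun x => if h : ∃ p : G × I, x = p.1 • s p.2 then φ h.choose.1 (n h.choose.2) else z,
    fun g i => ?_, fun x hx => dif_neg fun ⟨p, hp⟩ => hx p.1 p.2 hp⟩
  have h : ∃ p : G × I, g • s i = p.1 • s p.2 := ⟨(g, i), rfl⟩
  simp only [dif_pos h]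
  have hp := h.choose_spec
  generalize h.choose = p at hp
  obtain ⟨g', j⟩ := p
  simp only at hp ⊢
  -- Independence of the choice: two expressions of one point use the same representative and differ
  -- by an element of its stabilizer, which fixes `n i`.
  have hp' : (g'⁻¹ * g) • s i = s j := by rw [mul_smul, hp, inv_smul_smul]
  obtain rfl := hs i j _ hp'
  have h1 := hn i (g'⁻¹ * g) hp'
  calc φ g' (n i) = φ g' (φ (g'⁻¹ * g) (n i)) := by rw [h1]
    _ = φ g (n i) := by rw [← Equiv.Perm.mul_apply, ← map_mul, mul_inv_cancel_left]

/-- On a tree, every antisymmetric function on oriented edges is the differential of a function on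
vertices. -/
theorem SimpleGraph.IsTree.exists_sub_eq {V N : Type*} [AddCommGroup N] {T : SimpleGraph V}
    (hT : T.IsTree) (c : T.Dart → N) (hc : ∀ d, c d.symm = -c d) :
    ∃ m : V → N, ∀ d, m d.snd - m d.fst = c d := by
  classical
  obtain ⟨x₀⟩ := hT.connected.nonempty
  choose p hp _ using hT.existsUnique_path x₀
  -- The primitive is the sum of `c` along the path from `x₀`. Of two adjacent vertices, one lies on
  -- the path to the other, and antisymmetry covers both cases.
  have hconcat : ∀ {x y : V} (h : T.Adj x y), x ∈ (p y).support →
      ((p y).darts.map c).sum - ((p x).darts.map c).sum = c ⟨(x, y), h⟩ := by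
    intro x y h hx
    rw [hT.isAcyclic.path_concat (hp x) (hp y) h hx, SimpleGraph.Walk.darts_concat]
    simp
  refine ⟨fun x => ((p x).darts.map c).sum, fun d => ?_⟩
  by_cases hx : d.fst ∈ (p d.snd).support
  · exact hconcat d.adj hx
  · have hy := hT.isAcyclic.mem_support_of_ne_mem_support_of_adj_of_isPath (hp _) (hp _) d.adj hx
    have h := hconcat d.adj.symm hy
    have h' : c ⟨(d.snd, d.fst), d.adj.symm⟩ = -c d := hc d
    rw [h'] at h
    rw [← neg_sub, h, neg_neg]

namespace UnitaryRep

variable {G : Type u} [Group G] [TopologicalSpace G]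
  {M : Type w} [NormedAddCommGroup M] [InnerProductSpace ℂ M]

/-- The restriction of a cocycle to a subgroup. -/
def Z1.restrict {π : UnitaryRep G M} (b : π.Z1) (K : Subgroup G) : (π.restrict K).Z1 :=
  ⟨(b : C(G, M)).comp ⟨Subtype.val, continuous_subtype_val⟩, fun g h => Z1.map_mul b g h⟩

theorem coboundary_apply (π : UnitaryRep G M) (m : M) (g : G) :
    (π.coboundary m : C(G, M)) g = π.toHom g m - m := rfl

/-- `m : V → M` is equivariant for the affine action given by the cocycle `b`. -/
def IsEquivariant {V : Type*} [MulAction G V] (π : UnitaryRep G M) (b : π.Z1) (m : V → M) : Prop :=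
  ∀ g x, m (g • x) = π.toHom g (m x) + (b : C(G, M)) g

variable {V : Type v} [MulAction G V] {π : UnitaryRep G M}

theorem IsEquivariant.sub {b b' : π.Z1} {m m' : V → M} (h : π.IsEquivariant b m)
    (h' : π.IsEquivariant b' m') : π.IsEquivariant (b - b') (m - m') := fun g x => by
  simp only [Pi.sub_apply, h g x, h' g x, map_sub, Submodule.coe_sub, ContinuousMap.sub_apply]
  abel

theorem IsEquivariant.add_const {b : π.Z1} {m : V → M} (h : π.IsEquivariant b m) (ξ : M) :
    π.IsEquivariant (b - π.coboundary ξ) (fun x => m x + ξ) := fun g x => by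
  simp only [h g x, map_add, Submodule.coe_sub, ContinuousMap.sub_apply, coboundary_apply]
  abel

theorem IsEquivariant.eq_coboundary_of_forall_eq {b : π.Z1} {m : V → M}
    (h : π.IsEquivariant b m) (x₀ : V) (hm : ∀ x, m x = m x₀) : b = π.coboundary (-m x₀) := by
  ext g
  have h1 := h g x₀
  rw [hm] at h1
  rw [coboundary_apply, map_neg, sub_neg_eq_add, neg_add_eq_sub]
  exact eq_sub_of_add_eq' h1.symm

end UnitaryRep

/-- Each nonempty fibre is a left coset of the open stabilizer. -/
theorem continuous_smul_of_isOpen_stabilizer {G : Type u} [Group G] [TopologicalSpace G]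
    [IsTopologicalGroup G] {V : Type v} [TopologicalSpace V] [DiscreteTopology V] [MulAction G V]
    {x : V} (hx : IsOpen (MulAction.stabilizer G x : Set G)) :
    Continuous fun g : G => g • x := by
  refine continuous_discrete_rng.mpr fun y => ?_
  refine isOpen_iff_mem_nhds.mpr fun g hg => ?_
  have hg' : g • x = y := hg
  have h : (fun k : G => g⁻¹ * k) ⁻¹' (MulAction.stabilizer G x : Set G) ∈ 𝓝 g :=
    (hx.preimage (continuous_const_mul g⁻¹)).mem_nhds (by simp)
  filter_upwards [h] with k hk
  have hk' : (g⁻¹ * k) • x = x := hk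
  rw [mul_smul, inv_smul_eq_iff] at hk'
  exact hk'.trans hg'

section Dart

variable {G : Type u} [Group G] {V : Type v} [MulAction G V] {T : SimpleGraph V} [ActsOnGraph G T]

theorem smul_dart_fst (g : G) (d : T.Dart) : (g • d).fst = g • d.fst := rfl

theorem smul_dart_snd (g : G) (d : T.Dart) : (g • d).snd = g • d.snd := rfl

theorem smul_dart_symm (g : G) (d : T.Dart) : (g • d).symm = g • d.symm := rfl

namespace QuotientLift

variable (D : QuotientLift G T)

theorem eq_of_smul_vertexLift {i j : QuotVertex G V} {g : G}
    (h : g • D.vertexLift i = D.vertexLift j) : i = j := by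
  rw [← D.vertexLift_mk i, ← D.vertexLift_mk j, ← h]
  exact (Quotient.sound (show _ ∈ MulAction.orbit G _ from ⟨g, rfl⟩)).symm

theorem exists_eq_smul_vertexLift (x : V) : ∃ (g : G) (i : QuotVertex G V),
    x = g • D.vertexLift i := by
  obtain ⟨g, hg⟩ := Quotient.exact (D.vertexLift_mk (Quotient.mk'' x)).symm
  exact ⟨g, _, hg.symm⟩

theorem eq_of_smul_edgeLift {i j : D.A} {g : G} (h : g • D.edgeLift i = D.edgeLift j) :
    i = j := by
  refine Subtype.ext ?_
  rw [← D.edgeLift_mk i, ← D.edgeLift_mk j, ← h]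
  exact (Quotient.sound (show _ ∈ MulAction.orbit G _ from ⟨g, rfl⟩)).symm

/-- An orientation never contains both an edge and its opposite. Thus a function supported on the
translates of lifted edges vanishes on the opposites of lifted edges. -/
theorem symm_edgeLift_ne (i j : D.A) (g : G) : (D.edgeLift i).symm ≠ g • D.edgeLift j := by
  intro h
  have h1 : (i : QuotEdge G T).opp = j := by
    rw [← D.edgeLift_mk i, ← D.edgeLift_mk j]
    change Quotient.mk'' (D.edgeLift i).symm = _
    rw [h]
    exact Quotient.sound ⟨g, rfl⟩
  rcases D.orientation i with h2 | h2
  · exact h2.2 (h1 ▸ j.2)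
  · exact h2.2 i.2

theorem exists_eq_smul_edgeLift (d : T.Dart) : ∃ (g : G) (i : D.A),
    d = g • D.edgeLift i ∨ d.symm = g • D.edgeLift i := by
  have h : ∀ d : T.Dart, (Quotient.mk'' d : QuotEdge G T) ∈ D.A →
      ∃ (g : G) (i : D.A), d = g • D.edgeLift i := by
    intro d hd
    obtain ⟨g, hg⟩ := Quotient.exact (D.edgeLift_mk ⟨_, hd⟩).symm
    exact ⟨g, _, hg.symm⟩
  rcases D.orientation (Quotient.mk'' d) with h1 | h1
  · obtain ⟨g, i, hi⟩ := h d h1.1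
    exact ⟨g, i, Or.inl hi⟩
  · obtain ⟨g, i, hi⟩ := h d.symm h1.1
    exact ⟨g, i, Or.inr hi⟩

end QuotientLift

end Dart

/-! ### Integration on the tree and the map `ι` -/

section Tree

variable {G : Type u} [Group G] [TopologicalSpace G] {V : Type v} [MulAction G V]
  {T : SimpleGraph V} [ActsOnGraph G T]
  {M : Type w} [NormedAddCommGroup M] [InnerProductSpace ℂ M] {π : UnitaryRep G M}

open UnitaryRep

/-- A tree with an equivariant antisymmetric function `c` on oriented edges carries a cocycle `b`
and a `b`-equivariant function on vertices with differential `c`. -/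
theorem exists_isEquivariant_sub_eq [IsTopologicalGroup G] (hT : T.IsTree)
    (hopen : ∀ x : V, IsOpen (MulAction.stabilizer G x : Set G))
    (c : T.Dart → M) (hsymm : ∀ d, c d.symm = -c d)
    (hc : ∀ (g : G) d, c (g • d) = π.toHom g (c d)) :
    ∃ (b : π.Z1) (m : V → M), π.IsEquivariant b m ∧ ∀ d, m d.snd - m d.fst = c d := by
  obtain ⟨m, hm⟩ := hT.exists_sub_eq c hsymm
  obtain ⟨x₀⟩ := hT.connected.nonempty
  -- Equivariance of the differential makes this defect independent of the vertex; as a function of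
  -- `g` it is the cocycle sought.
  have hconst : ∀ g x, m (g • x) - π.toHom g (m x) = m (g • x₀) - π.toHom g (m x₀) := by
    intro g x
    obtain ⟨p⟩ := hT.connected.preconnected x x₀
    induction p with
    | nil => rfl
    | @cons x y _ h _ ih =>
      rw [← ih]
      have h1 := hm (g • ⟨(x, y), h⟩)
      rw [hc, ← hm ⟨(x, y), h⟩, map_sub] at h1
      change m (g • y) - m (g • x) = π.toHom g (m y) - π.toHom g (m x) at h1
      rw [sub_eq_iff_eq_add.mp h1]
      abel
  have hcont : Continuous fun g : G => m (g • x₀) - π.toHom g (m x₀) := by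
    refine Continuous.sub ?_ (π.strongly_continuous _)
    let _ : TopologicalSpace V := ⊥
    have : DiscreteTopology V := ⟨rfl⟩
    exact (continuous_of_discreteTopology (f := m)).comp
      (continuous_smul_of_isOpen_stabilizer (hopen x₀))
  refine ⟨⟨⟨_, hcont⟩, fun g h => ?_⟩, m, fun g x => ?_, hm⟩
  · change m ((g * h) • x₀) - π.toHom (g * h) (m x₀) = _ - _ + π.toHom g (_ - _)
    rw [← hconst g (h • x₀), mul_smul, π.mul_apply, map_sub]
    abel
  · change _ = _ + (m (g • x₀) - π.toHom g (m x₀))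
    rw [← hconst g x]
    abel

namespace QuotientLift

variable (D : QuotientLift G T)

/-- The differential of an equivariant function on vertices, on the lifted edges. -/
def diff {b : π.Z1} {m : V → M} (hm : π.IsEquivariant b m) (e : D.A) :
    π.fixed (D.edgeGroup e) :=
  ⟨m (D.edgeLift e).snd - m (D.edgeLift e).fst, fun g hg => by
    have h : g • D.edgeLift e = D.edgeLift e := hg
    have h1 := hm g (D.edgeLift e).snd
    have h2 := hm g (D.edgeLift e).fst
    rw [← smul_dart_snd, h] at h1
    rw [← smul_dart_fst, h] at h2
    conv_rhs => rw [h1, h2]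
    rw [map_sub, add_sub_add_right_eq_sub]⟩

theorem coe_diff {b : π.Z1} {m : V → M} (hm : π.IsEquivariant b m) (e : D.A) :
    (D.diff hm e : M) = m (D.edgeLift e).snd - m (D.edgeLift e).fst := rfl

theorem diff_sub {b b' : π.Z1} {m m' : V → M} (hm : π.IsEquivariant b m)
    (hm' : π.IsEquivariant b' m') : D.diff (hm.sub hm') = D.diff hm - D.diff hm' := by
  ext e
  simp only [coe_diff, Pi.sub_apply, Submodule.coe_sub]
  abel

theorem diff_add_const {b : π.Z1} {m : V → M} (hm : π.IsEquivariant b m) (ξ : M) :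
    D.diff (hm.add_const ξ) = D.diff hm := by
  ext e
  simp only [coe_diff]
  abel

/-- A choice of fixed points of the vertex groups for an affine action extends equivariantly to
all vertices. -/
theorem exists_isEquivariant_vertexLift (b : π.Z1) (n : QuotVertex G V → M)
    (hn : ∀ q, ∀ h ∈ D.vertexGroup q, π.toHom h (n q) + (b : C(G, M)) h = n q) :
    ∃ m : V → M, π.IsEquivariant b m ∧ ∀ q, m (D.vertexLift q) = n q := by
  obtain ⟨m, hm, -⟩ := exists_equivariant_extension (π.affineAction b) D.vertexLift
    (fun i j g h => D.eq_of_smul_vertexLift h) n hn 0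
  refine ⟨m, fun g x => ?_, fun q => ?_⟩
  · obtain ⟨h, i, rfl⟩ := D.exists_eq_smul_vertexLift x
    rw [← mul_smul, hm, hm, map_mul, Equiv.Perm.mul_apply]
    rfl
  · have h := hm 1 q
    rwa [one_smul, map_one] at h

/-- The map `ι` is the differential of equivariant functions on the vertices of the tree. -/
theorem mem_range_iota_iff (c : ∀ e : D.A, π.fixed (D.edgeGroup e)) :
    c ∈ Set.range (D.iota π) ↔
      ∃ (f : V → M) (hf : π.IsEquivariant 0 f), c = D.diff hf := by
  have key : ∀ (f : V → M) (hf : π.IsEquivariant 0 f) (n : ∀ x, π.fixed (D.vertexGroup x)),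
      (∀ q, f (D.vertexLift q) = n q) → D.iota π n = D.diff hf := by
    intro f hf n hn
    ext e
    rw [coe_diff, D.edgeLift_term, D.edgeLift_init, hf, hn, hn]
    simp [iota]
  constructor
  · rintro ⟨n, rfl⟩
    obtain ⟨f, hf, hfn⟩ := D.exists_isEquivariant_vertexLift (π := π) 0 (fun q => n q)
      fun q h hh => by simpa using (n q).2 h hh
    exact ⟨f, hf, key f hf n hfn⟩
  · rintro ⟨f, hf, rfl⟩
    refine ⟨fun q => ⟨f (D.vertexLift q), fun h hh => ?_⟩, key f hf _ fun q => rfl⟩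
    have h1 := hf h (D.vertexLift q)
    have h2 : h • D.vertexLift q = D.vertexLift q := hh
    rw [h2] at h1
    simpa using h1.symm

/-- The equation `b = 0` is a hypothesis so that differences of cocycles that are only provably zero
can be used. -/
theorem diff_mem_range_iota {b : π.Z1} {m : V → M} (hm : π.IsEquivariant b m) (hb : b = 0) :
    D.diff hm ∈ Set.range (D.iota π) := by
  subst hb
  exact (D.mem_range_iota_iff _).mpr ⟨m, hm, rfl⟩

/-- Every family of fixed vectors of the edge groups is the differential of a function that is
equivariant for the affine action of some cocycle. -/
theorem exists_diff_eq [IsTopologicalGroup G] (hT : T.IsTree)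
    (hopen : ∀ x : V, IsOpen (MulAction.stabilizer G x : Set G))
    (c : ∀ e : D.A, π.fixed (D.edgeGroup e)) :
    ∃ (b : π.Z1) (m : V → M) (hm : π.IsEquivariant b m), D.diff hm = c := by
  let φ : G →* Equiv.Perm M := π.affineAction 0
  have hφ : ∀ g x, φ g x = π.toHom g x := fun g x => by simp [φ, affineAction_apply]
  obtain ⟨c', hc', hz⟩ := exists_equivariant_extension φ D.edgeLift
    (fun i j g h => D.eq_of_smul_edgeLift h) (fun e => (c e : M))
    (fun i h hh => (hφ h _).trans ((c i).2 h hh)) 0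
  have heq : ∀ (g : G) d, c' (g • d) = π.toHom g (c' d) := by
    intro g d
    by_cases hd : ∃ (h : G) (i : D.A), d = h • D.edgeLift i
    · obtain ⟨h, i, rfl⟩ := hd
      rw [← mul_smul, hc', hc', hφ, hφ, π.mul_apply]
    · push Not at hd
      rw [hz d hd, hz (g • d), map_zero]
      intro h i hi
      refine hd (g⁻¹ * h) i ?_
      rw [mul_smul, ← hi, inv_smul_smul]
  -- `c'` is zero off the translates of lifted edges, so antisymmetrizing it leaves its values on
  -- the lifted edges unchanged.
  obtain ⟨b, m, hm, hmc⟩ := exists_isEquivariant_sub_eq (π := π) hT hopen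
    (fun d => c' d - c' d.symm)
    (fun d => by rw [SimpleGraph.Dart.symm_symm, neg_sub])
    (fun g d => by rw [smul_dart_symm, heq, heq, map_sub])
  refine ⟨b, m, hm, ?_⟩
  ext e
  have h1 := hc' 1 e
  rw [one_smul, map_one] at h1
  rw [coe_diff, hmc, hz _ (fun g i => D.symm_edgeLift_ne e i g), sub_zero, h1]
  rfl

/-- If the differentials of equivariant functions on the vertices of a tree tend to zero on the
lifted edges, then all differences of values tend to zero. -/
theorem tendsto_sub_of_tendsto_diff (hT : T.IsTree) {ι : Type*} {F : Filter ι} {b : ι → π.Z1}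
    {m : ι → V → M} (hm : ∀ i, π.IsEquivariant (b i) (m i))
    (h : ∀ e, Tendsto (fun i => (D.diff (hm i) e : M)) F (𝓝 0)) (x y : V) :
    Tendsto (fun i => m i x - m i y) F (𝓝 0) := by
  have hlift : ∀ (g : G) (e : D.A) (d : T.Dart), d = g • D.edgeLift e →
      Tendsto (fun i => m i d.snd - m i d.fst) F (𝓝 0) := by
    rintro g e d rfl
    refine (tendsto_iff_norm_sub_tendsto_zero.mp (h e)).congr (fun i => ?_) |>
      tendsto_zero_iff_norm_tendsto_zero.mpr
    rw [smul_dart_fst, smul_dart_snd, hm, hm, add_sub_add_right_eq_sub, ← map_sub,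
      LinearIsometryEquiv.norm_map, sub_zero, coe_diff]
  obtain ⟨p⟩ := hT.connected.preconnected x y
  induction p with
  | nil => simpa using tendsto_const_nhds
  | @cons x z _ hxz _ ih =>
    have hstep : Tendsto (fun i => m i x - m i z) F (𝓝 0) := by
      obtain ⟨g, e, hd | hd⟩ := D.exists_eq_smul_edgeLift ⟨(x, z), hxz⟩
      · simpa using (hlift g e _ hd).neg
      · exact hlift g e _ hd
    simpa using hstep.add ih

/-- An equivariant function whose differential vanishes on the lifted edges is constant. -/
theorem eq_of_diff_eq_zero (hT : T.IsTree) {b : π.Z1} {m : V → M} (hm : π.IsEquivariant b m)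
    (h0 : D.diff hm = 0) (x y : V) : m x = m y := by
  -- For a constant family, tending to zero means being zero.
  have h := D.tendsto_sub_of_tendsto_diff hT (F := (⊤ : Filter Unit)) (fun _ => hm)
    (fun e => by simp only [h0]; exact tendsto_const_nhds) x y
  exact sub_eq_zero.mp (tendsto_nhds_unique tendsto_const_nhds h)

/-- If the vertex groups have Property (T), every cocycle `b` admits an equivariant function on the
vertices whose value on each lifted vertex is controlled by the values of `b` on a Kazhdan set. -/
theorem exists_isEquivariant_of_isKazhdanPair [IsTopologicalGroup G] [CompleteSpace M]
    {Q : ∀ q, Set (D.vertexGroup q)} (hQ : ∀ q, IsCompact (Q q)) {ε : QuotVertex G V → ℝ}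
    (hε : ∀ q, 0 < ε q) (hK : ∀ q, IsKazhdanPair.{u, w} (D.vertexGroup q) (Q q) (ε q))
    (b : π.Z1) :
    ∃ m : V → M, π.IsEquivariant b m ∧ ∀ q r, 0 ≤ r →
      (∀ h ∈ Q q, ‖(b : C(G, M)) h‖ ≤ r) → ε q * ‖m (D.vertexLift q)‖ ≤ r := by
  choose n hn hnb using fun q =>
    exists_norm_le_eq_sub_of_isKazhdanPair (hQ q) (hε q) (hK q) (π.restrict (D.vertexGroup q))
      (Z1.restrict b (D.vertexGroup q))
  obtain ⟨m, hm, hmn⟩ := D.exists_isEquivariant_vertexLift b (fun q => -n q) fun q h hh => by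
    have h1 : (b : C(G, M)) h = π.toHom h (n q) - n q := hnb q ⟨h, hh⟩
    rw [h1, map_neg]
    abel
  refine ⟨m, hm, fun q r hr hb => ?_⟩
  rw [hmn, norm_neg]
  exact hn q r hr hb

/-! ### The two equivalences -/

/-- Cohomology vanishes if and only if `ι` is onto. -/
theorem forall_mem_B1_iff_surjective_iota [IsTopologicalGroup G] (hT : T.IsTree)
    (hopen : ∀ x : V, IsOpen (MulAction.stabilizer G x : Set G))
    (hex : ∀ b : π.Z1, ∃ m : V → M, π.IsEquivariant b m) :
    (∀ b : π.Z1, b ∈ π.B1) ↔ Function.Surjective (D.iota π) := by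
  obtain ⟨x₀⟩ := hT.connected.nonempty
  constructor
  · intro h c
    obtain ⟨b, m, hm, rfl⟩ := D.exists_diff_eq hT hopen c
    obtain ⟨ξ, rfl⟩ := h b
    -- Adding the constant `ξ` turns the cocycle `coboundary ξ` into zero without changing the
    -- differential.
    rw [← D.diff_add_const hm ξ]
    exact D.diff_mem_range_iota _ (sub_self _)
  · intro h b
    obtain ⟨m, hm⟩ := hex b
    obtain ⟨f, hf, hfm⟩ := (D.mem_range_iota_iff _).mp (h (D.diff hm))
    have h0 : D.diff (hm.sub hf) = 0 := by rw [D.diff_sub hm hf, hfm, sub_self]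
    have h1 := (hm.sub hf).eq_coboundary_of_forall_eq x₀
      fun x => D.eq_of_diff_eq_zero hT _ h0 x x₀
    rw [sub_zero] at h1
    exact ⟨_, h1.symm⟩

/-- If `ι` has dense image, the coboundaries are dense. -/
theorem dense_of_denseRange_iota [IsTopologicalGroup G] (hT : T.IsTree)
    (hopen : ∀ x : V, IsOpen (MulAction.stabilizer G x : Set G))
    (hex : ∀ b : π.Z1, ∃ m : V → M, π.IsEquivariant b m) (h : DenseRange (D.iota π)) :
    Dense (π.B1 : Set π.Z1) := by
  intro b
  obtain ⟨x₀⟩ := hT.connected.nonempty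
  obtain ⟨m, hm⟩ := hex b
  -- A filter replaces sequences, since the product may have uncountably many factors.
  let F := comap (Subtype.val : Set.range (D.iota π) → _) (𝓝 (D.diff hm))
  have hF : F.NeBot := mem_closure_iff_comap_neBot.mp (h (D.diff hm))
  choose f hf hfc using fun c : Set.range (D.iota π) => (D.mem_range_iota_iff _).mp c.2
  have hlim : ∀ x y, Tendsto (fun c => (m - f c) x - (m - f c) y) F (𝓝 0) := by
    refine D.tendsto_sub_of_tendsto_diff hT (fun c => hm.sub (hf c)) fun e => ?_
    have h1 : Tendsto (fun c : Set.range (D.iota π) => ((c : ∀ e, π.fixed (D.edgeGroup e)) e : M))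
        F (𝓝 (D.diff hm e)) :=
      (Continuous.comp (f := fun c : ∀ e, π.fixed (D.edgeGroup e) => c e) continuous_subtype_val
        (continuous_apply e)).continuousAt.tendsto.comp tendsto_comap
    have h2 := h1.const_sub (D.diff hm e : M)
    rw [sub_self] at h2
    refine h2.congr fun c => ?_
    rw [D.diff_sub hm (hf c), ← hfc]
    rfl
  let ξ : Set.range (D.iota π) → M := fun c => -(m - f c) x₀
  have hval : ∀ c g, (b : C(G, M)) g - (π.coboundary (ξ c) : C(G, M)) g =
      (m - f c) (g • x₀) - (m - f c) x₀ := by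
    intro c g
    have h1 := (hm.sub (hf c)) g x₀
    rw [sub_zero] at h1
    rw [h1, coboundary_apply, show ξ c = -(m - f c) x₀ from rfl, map_neg]
    abel
  refine mem_closure_of_tendsto (f := fun c => π.coboundary (ξ c)) (b := F) ?_
    (Eventually.of_forall fun c => ⟨_, rfl⟩)
  refine tendsto_subtype_rng.mpr
    (ContinuousMap.tendsto_iff_forall_isCompact_tendstoUniformlyOn.mpr fun Q hQ => ?_)
  let _ : TopologicalSpace V := ⊥
  have : DiscreteTopology V := ⟨rfl⟩
  -- By `hval` the error at `g` depends only on `g • x₀`, so uniformity on `Q` reduces to finitely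
  -- many vertices.
  have hfin : ((fun g : G => g • x₀) '' Q).Finite :=
    (hQ.image (continuous_smul_of_isOpen_stabilizer (hopen x₀))).finite_of_discrete
  rw [Metric.tendstoUniformlyOn_iff]
  intro ε hε
  have hev : ∀ᶠ c in F, ∀ y ∈ (fun g : G => g • x₀) '' Q, ‖(m - f c) y - (m - f c) x₀‖ < ε :=
    (eventually_all_finite hfin).mpr fun y _ => by
      have h1 := (hlim y x₀).norm
      rw [norm_zero] at h1
      exact h1.eventually_lt_const hε
  filter_upwards [hev] with c hc g hg
  rw [dist_eq_norm, hval]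
  exact hc _ ⟨g, hg, rfl⟩

/-- If the vertex groups have Property (T) and the coboundaries are dense, `ι` has dense image. -/
theorem denseRange_iota_of_dense [IsTopologicalGroup G] [CompleteSpace M] (hT : T.IsTree)
    (hopen : ∀ x : V, IsOpen (MulAction.stabilizer G x : Set G))
    {Q : ∀ q, Set (D.vertexGroup q)} (hQ : ∀ q, IsCompact (Q q)) {ε : QuotVertex G V → ℝ}
    (hε : ∀ q, 0 < ε q) (hK : ∀ q, IsKazhdanPair.{u, w} (D.vertexGroup q) (Q q) (ε q))
    (h : Dense (π.B1 : Set π.Z1)) : DenseRange (D.iota π) := by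
  intro c
  obtain ⟨b, m, hm, rfl⟩ := D.exists_diff_eq hT hopen c
  let F := comap (fun β : (π.B1 : Set π.Z1) => (β : π.Z1)) (𝓝 b)
  have hF : F.NeBot := mem_closure_iff_comap_neBot.mp (h b)
  have hunif : ∀ K : Set G, IsCompact K → ∀ r > 0, ∀ᶠ β in F,
      ∀ g ∈ K, ‖((b - β.1 : π.Z1) : C(G, M)) g‖ ≤ r := by
    intro K hKc r hr
    have h1 : Tendsto (fun β : (π.B1 : Set π.Z1) => ((β : π.Z1) : C(G, M))) F (𝓝 b) :=
      continuous_subtype_val.continuousAt.tendsto.comp tendsto_comap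
    have h2 := Metric.tendstoUniformlyOn_iff.mp
      (ContinuousMap.tendsto_iff_forall_isCompact_tendstoUniformlyOn.mp h1 K hKc) r hr
    filter_upwards [h2] with β hβ g hg
    have h3 := (hβ g hg).le
    rwa [dist_eq_norm] at h3
  choose m' hm' hsmall using fun β : (π.B1 : Set π.Z1) =>
    D.exists_isEquivariant_of_isKazhdanPair hQ hε hK (b - β.1)
  have hvertex : ∀ q, Tendsto (fun β => m' β (D.vertexLift q)) F (𝓝 0) := by
    intro q
    refine Metric.tendsto_nhds.mpr fun r hr => ?_
    filter_upwards [hunif _ ((hQ q).image continuous_subtype_val) (ε q * (r / 2))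
      (mul_pos (hε q) (half_pos hr))] with β hβ
    have h1 := hsmall β q (ε q * (r / 2)) (mul_pos (hε q) (half_pos hr)).le
      fun h hh => hβ h ⟨h, hh, rfl⟩
    rw [dist_zero_right]
    have h2 := le_of_mul_le_mul_left h1 (hε q)
    linarith
  have hpoint : ∀ g, Tendsto (fun β : (π.B1 : Set π.Z1) => ((b - β.1 : π.Z1) : C(G, M)) g) F
      (𝓝 0) := by
    intro g
    refine Metric.tendsto_nhds.mpr fun r hr => ?_
    filter_upwards [hunif {g} isCompact_singleton (r / 2) (half_pos hr)] with β hβ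
    rw [dist_zero_right]
    linarith [hβ g rfl]
  have hdiff : Tendsto (fun β => D.diff hm - D.diff (hm' β)) F (𝓝 (D.diff hm)) := by
    refine tendsto_pi_nhds.mpr fun e => tendsto_subtype_rng.mpr ?_
    have h1 : Tendsto (fun β => (D.diff (hm' β) e : M)) F (𝓝 0) := by
      -- The initial vertex is a translate by `(t e)⁻¹`, so the value there also involves the
      -- cocycle at `(t e)⁻¹`; this is where `hpoint` enters.
      simp only [coe_diff, D.edgeLift_term, D.edgeLift_init, (hm' _) (D.t e)⁻¹]
      have h2 := (π.toHom (D.t e)⁻¹).continuous.continuousAt.tendsto.comp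
        (hvertex (e : QuotEdge G T).init)
      rw [map_zero] at h2
      simpa using (hvertex (e : QuotEdge G T).term).sub (h2.add (hpoint (D.t e)⁻¹))
    simpa using h1.const_sub (D.diff hm e : M)
  refine mem_closure_of_tendsto hdiff (Eventually.of_forall fun β => ?_)
  -- With `β = coboundary ξ`, the function `m + ξ - m' β` is equivariant for `(b - β) - (b - β) =
  -- 0`.
  obtain ⟨ξ, hξ⟩ := β.2
  rw [← D.diff_add_const hm ξ, ← D.diff_sub]
  exact D.diff_mem_range_iota _ (by rw [hξ, sub_self])

end QuotientLift

end Tree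

theorem mainTheorem1
    {G : Type u} [Group G] [TopologicalSpace G] [IsTopologicalGroup G] [LocallyCompactSpace G]
    {V : Type v} [MulAction G V] (T : SimpleGraph V) (hT : T.IsTree) [ActsOnGraph G T]
    (hinv : WithoutInversion G T)
    (hopen : ∀ x : V, IsOpen (MulAction.stabilizer G x : Set G))
    (hPropT : ∀ x : V, HasPropertyT.{u, w} (MulAction.stabilizer G x))
    {M : Type w} [NormedAddCommGroup M] [InnerProductSpace ℂ M] [CompleteSpace M]
    (π : UnitaryRep G M) (D : QuotientLift G T) :
    (Subsingleton π.H1 ↔ Function.Surjective (D.iota π)) ∧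
      (Subsingleton π.ReducedH1 ↔ DenseRange (D.iota π)) := by
  choose Q hQ ε hε hK using fun q =>
    HasPropertyT.exists_isKazhdanPair (hPropT (D.vertexLift q))
  have hex : ∀ b : π.Z1, ∃ m : V → M, π.IsEquivariant b m := fun b =>
    (D.exists_isEquivariant_of_isKazhdanPair hQ hε hK b).imp fun _ h => h.1
  rw [Submodule.Quotient.subsingleton_iff, Submodule.Quotient.subsingleton_iff]
  refine ⟨?_, ?_⟩
  · rw [Submodule.eq_top_iff', D.forall_mem_B1_iff_surjective_iota hT hopen hex]
  · rw [← Submodule.dense_iff_topologicalClosure_eq_top]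
    exact ⟨D.denseRange_iota_of_dense hT hopen hQ hε hK,
      D.dense_of_denseRange_iota hT hopen hex⟩
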